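/- Let $p$ be a prime and let $G$ be a finite $p$-group of order $p^n$. The *$p$-lower central series* of $G$ is the smallest filtration $G=\Gamma_1\supseteq\Gamma_2\supseteq\cdots$ by subgroups such that $[\Gamma_i,\Gamma_j]\subseteq\Gamma_{i+j}$ and $g\in\Gamma_i\Rightarrow g^p\in\Gamma_{ip}$ for all $i,j\ge 1$. Let $\ell$ be the least integer with $\Gamma_{\ell+1}=1$. Each quotient $\Gamma_j/\Gamma_{j+1}$ is an $\mathbb F_p$-vector space, and the *$p$-degrees* of $G$ are $r_j=\dim_{\mathbb F_p}\Gamma_j/\Gamma_{j+1}$ for $1\le j\le\ell$. Put $$\delta_G=\frac{\left(\sum_{j=1}^{\ell} j\,r_j\right)^2}{\sum_{j=1}^{\ell} j^2 r_j}$$ (with $\delta_G=0$ if $G$ is trivial). The *multiplication tensor* of $G$ over $\mathbb F_p$ is the function $T_G\colon G\times G\times G\to\mathbb F_p$ of structure constants of $\mathbb F_p[G]$ in the basis of group elements, that is, $T_G(x,y,z)=1$ if $xy=z$ and $0$ otherwise. The *slice rank* of a function $F\colon X\times Y\times Z\to\mathbb F$, with $X,Y,Z$ finite sets and $\mathbb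 F$ a field, is the smallest $r$ for which there are integers $0\le a\le b\le r$ and $\mathbb F$-valued functions $f_i,g_i$ with $$F(x,y,z)=\sum_{i=1}^{a} f_i(x,y)g_i(z)+\sum_{i=a+1}^{b} f_i(x,z)g_i(y)+\sum_{i=b+1}^{r} f_i(y,z)g_i(x).$$ Then $$\operatorname{slice-rank}(T_G)\le 3\,|G|\,e^{-\delta_G/18}.$$ In particular, $\operatorname{slice-rank}(T_G)\le p^n/e^{\Omega(\delta_G)}$; that is, there are absolute constants $c>0$ and $D$ such that $\operatorname{slice-rank}(T_G)\le p^n/e^{c\,\delta_G}$ for every prime $p$ and every group $G$ of order $p^n$ with $\delta_G\ge D$. -/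

import Mathlib

universe u

/-! ### Slice rank -/

/-- The tensor `F : X × Y × Z → 𝕜` is a sum of `r` slices: `a` terms `f(x,y) g(z)`,
`b` terms `f(x,z) g(y)` and `c` terms `f(y,z) g(x)`, where `a + b + c = r`. -/
def HasSliceDecomposition {𝕜 X Y Z : Type*} [Field 𝕜] (F : X → Y → Z → 𝕜) (r : ℕ) : Prop :=
  ∃ a b c : ℕ, a + b + c = r ∧
    ∃ (f₁ : Fin a → X → Y → 𝕜) (g₁ : Fin a → Z → 𝕜)
      (f₂ : Fin b → X → Z → 𝕜) (g₂ : Fin b → Y → 𝕜)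
      (f₃ : Fin c → Y → Z → 𝕜) (g₃ : Fin c → X → 𝕜),
      ∀ x y z, F x y z =
        ∑ i, f₁ i x y * g₁ i z + ∑ i, f₂ i x z * g₂ i y + ∑ i, f₃ i y z * g₃ i x

/-- The slice rank of a tensor. -/
noncomputable def sliceRank {𝕜 X Y Z : Type*} [Field 𝕜] (F : X → Y → Z → 𝕜) : ℕ :=
  sInf {r | HasSliceDecomposition F r}

/-- On finite sets a slice decomposition exists, so that the infimum in `sliceRank` is a
minimum. -/
theorem hasSliceDecomposition_sliceRank {𝕜 X Y Z : Type*} [Field 𝕜] [Finite Z]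
    (F : X → Y → Z → 𝕜) : HasSliceDecomposition F (sliceRank F) := by
  classical
  have hne : {r | HasSliceDecomposition F r}.Nonempty := by
    let e := Finite.equivFin Z
    refine ⟨Nat.card Z, Nat.card Z, 0, 0, rfl, fun i x y => F x y (e.symm i),
      fun i z => if e z = i then 1 else 0, Fin.elim0, Fin.elim0, Fin.elim0, Fin.elim0, ?_⟩
    intro x y z
    simp
  exact Nat.sInf_mem hne

/-! ### Multiplication tensors -/

/-- The multiplication tensor of an algebra `D` relative to a basis `b`: the structure constants
`T i j k` with `b i * b j = ∑ k, T i j k • b k`. -/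
noncomputable def algebraMulTensor {ι 𝕜 D : Type*} [Field 𝕜] [Ring D] [Algebra 𝕜 D]
    (b : Module.Basis ι 𝕜 D) : ι → ι → ι → 𝕜 :=
  fun i j k => b.repr (b i * b j) k

/-- The multiplication tensor of a group `G` over `𝕜`: the multiplication tensor of the group
algebra relative to the basis of group elements. -/
noncomputable def groupMulTensor (𝕜 : Type*) [Field 𝕜] (G : Type*) [Group G] : G → G → G → 𝕜 :=
  algebraMulTensor (MonoidAlgebra.basis G 𝕜)

theorem groupMulTensor_apply (𝕜 : Type*) [Field 𝕜] (G : Type*) [Group G] [DecidableEq G]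
    (x y z : G) : groupMulTensor 𝕜 G x y z = if x * y = z then 1 else 0 := by
  simp [groupMulTensor, algebraMulTensor, MonoidAlgebra.basis, MonoidAlgebra.single_mul_single,
    Finsupp.single_apply]

/-! ### The `p`-lower central series and the `p`-degrees -/

/-- `N 1 ⊇ N 2 ⊇ …` is a filtration of `G` starting at `G`, with `[N i, N j] ⊆ N (i + j)` and
`g ∈ N i → g ^ p ∈ N (i * p)` for `i, j ≥ 1`. The index `0` is not part of the filtration; `N 0` is
set to `G` by convention. -/
structure IsPFiltration (p : ℕ) {G : Type*} [Group G] (N : ℕ → Subgroup G) : Prop where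
  zero : N 0 = ⊤
  one : N 1 = ⊤
  succ_le : ∀ i, 1 ≤ i → N (i + 1) ≤ N i
  commutator_le : ∀ i j, 1 ≤ i → 1 ≤ j → ⁅N i, N j⁆ ≤ N (i + j)
  pow_mem : ∀ i, 1 ≤ i → ∀ g ∈ N i, g ^ p ∈ N (i * p)

/-- The `p`-lower central series `Γ 1 ⊇ Γ 2 ⊇ …` of `G`, the smallest filtration as in
`IsPFiltration`. -/
def pLowerCentralSeries (p : ℕ) (G : Type*) [Group G] (i : ℕ) : Subgroup G :=
  ⨅ (N : ℕ → Subgroup G) (_ : IsPFiltration p N), N i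

theorem mem_pLowerCentralSeries {p : ℕ} {G : Type*} [Group G] {i : ℕ} {g : G} :
    g ∈ pLowerCentralSeries p G i ↔ ∀ N : ℕ → Subgroup G, IsPFiltration p N → g ∈ N i := by
  simp [pLowerCentralSeries, Subgroup.mem_iInf]

/-- The `p`-lower central series is at most every filtration as in `IsPFiltration`. -/
theorem pLowerCentralSeries_le {p : ℕ} {G : Type*} [Group G] {N : ℕ → Subgroup G}
    (hN : IsPFiltration p N) (i : ℕ) : pLowerCentralSeries p G i ≤ N i :=
  fun _ hg => mem_pLowerCentralSeries.1 hg N hN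

/-- The `p`-lower central series is itself such a filtration. -/
theorem isPFiltration_pLowerCentralSeries (p : ℕ) (G : Type*) [Group G] :
    IsPFiltration p (pLowerCentralSeries p G) where
  zero := by
    refine eq_top_iff.2 fun g _ => mem_pLowerCentralSeries.2 fun N hN => ?_
    rw [hN.zero]
    exact Subgroup.mem_top g
  one := by
    refine eq_top_iff.2 fun g _ => mem_pLowerCentralSeries.2 fun N hN => ?_
    rw [hN.one]
    exact Subgroup.mem_top g
  succ_le i hi g hg := mem_pLowerCentralSeries.2 fun N hN =>
    hN.succ_le i hi (mem_pLowerCentralSeries.1 hg N hN)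
  commutator_le i j hi hj := Subgroup.commutator_le.2 fun a ha b hb =>
    mem_pLowerCentralSeries.2 fun N hN =>
      Subgroup.commutator_le.1 (hN.commutator_le i j hi hj) a (mem_pLowerCentralSeries.1 ha N hN)
        b (mem_pLowerCentralSeries.1 hb N hN)
  pow_mem i hi g hg := mem_pLowerCentralSeries.2 fun N hN =>
    hN.pow_mem i hi g (mem_pLowerCentralSeries.1 hg N hN)

theorem pLowerCentralSeries_commutator_le (p : ℕ) (G : Type*) [Group G] (j : ℕ) :
    ⁅pLowerCentralSeries p G j, pLowerCentralSeries p G j⁆ ≤ pLowerCentralSeries p G (j + 1) := by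
  have h := isPFiltration_pLowerCentralSeries p G
  have hle : ∀ k, pLowerCentralSeries p G (j + 1 + k) ≤ pLowerCentralSeries p G (j + 1) := by
    intro k
    induction k with
    | zero => exact le_rfl
    | succ k ih => exact (h.succ_le (j + 1 + k) (by omega)).trans ih
  rcases Nat.eq_zero_or_pos j with rfl | hj
  · rw [zero_add, h.one]
    exact le_top
  · have h2 := hle (j - 1)
    rw [show j + 1 + (j - 1) = j + j by omega] at h2
    exact (h.commutator_le j j hj hj).trans h2

theorem pLowerCentralSeries_pow_mem (p : ℕ) [Fact p.Prime] (G : Type*) [Group G] (j : ℕ)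
    {g : G} (hg : g ∈ pLowerCentralSeries p G j) : g ^ p ∈ pLowerCentralSeries p G (j + 1) := by
  have h := isPFiltration_pLowerCentralSeries p G
  have hle : ∀ k, pLowerCentralSeries p G (j + 1 + k) ≤ pLowerCentralSeries p G (j + 1) := by
    intro k
    induction k with
    | zero => exact le_rfl
    | succ k ih => exact (h.succ_le (j + 1 + k) (by omega)).trans ih
  rcases Nat.eq_zero_or_pos j with rfl | hj
  · rw [zero_add, h.one]
    exact Subgroup.mem_top _
  · have hp : 2 ≤ p := (Fact.out : p.Prime).two_le
    have hjp : j + 1 ≤ j * p := by nlinarith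
    have h2 := hle (j * p - (j + 1))
    rw [Nat.add_sub_cancel' hjp] at h2
    exact h2 (h.pow_mem j hj g hg)

instance pLowerCentralSeries_normal (p : ℕ) (G : Type*) [Group G] (j : ℕ) :
    ((pLowerCentralSeries p G (j + 1)).subgroupOf (pLowerCentralSeries p G j)).Normal where
  conj_mem a ha g := by
    rw [Subgroup.mem_subgroupOf] at ha ⊢
    have hc : (g : G) * a * (g : G)⁻¹ * (a : G)⁻¹ ∈ pLowerCentralSeries p G (j + 1) :=
      Subgroup.commutator_le.1 (pLowerCentralSeries_commutator_le p G j) g g.2 a a.2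
    have hm := mul_mem hc ha
    simpa [commutatorElement_def, mul_assoc] using hm

/-- The quotient `Γ j / Γ (j + 1)`. -/
abbrev PLayer (p : ℕ) (G : Type*) [Group G] (j : ℕ) : Type _ :=
  pLowerCentralSeries p G j ⧸ (pLowerCentralSeries p G (j + 1)).subgroupOf
    (pLowerCentralSeries p G j)

/-- The quotient `Γ j / Γ (j + 1)` is commutative. -/
instance pLayerCommGroup (p : ℕ) (G : Type*) [Group G] (j : ℕ) : CommGroup (PLayer p G j) :=
  { (inferInstance : Group (PLayer p G j)) with
    mul_comm := by
      intro x y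
      induction x using QuotientGroup.induction_on with
      | H a =>
        induction y using QuotientGroup.induction_on with
        | H b =>
          rw [← QuotientGroup.mk_mul, ← QuotientGroup.mk_mul, QuotientGroup.eq,
            Subgroup.mem_subgroupOf]
          have hc := Subgroup.commutator_le.1 (pLowerCentralSeries_commutator_le p G j)
            (b : G)⁻¹ (inv_mem b.2) (a : G)⁻¹ (inv_mem a.2)
          simpa [commutatorElement_def, mul_assoc] using hc }

/-- The quotient `Γ j / Γ (j + 1)`, written additively, as a vector space over `𝔽_p`. -/
instance pLayerModule (p : ℕ) [Fact p.Prime] (G : Type*) [Group G] (j : ℕ) :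
    Module (ZMod p) (Additive (PLayer p G j)) :=
  AddCommGroup.zmodModule (by
    intro x
    have key : ∀ y : PLayer p G j, y ^ p = 1 := by
      intro y
      induction y using QuotientGroup.induction_on with
      | H a =>
        rw [← QuotientGroup.mk_pow, QuotientGroup.eq_one_iff, Subgroup.mem_subgroupOf]
        simpa using pLowerCentralSeries_pow_mem p G j a.2
    exact congrArg Additive.ofMul (key x.toMul))

/-- The `p`-degree `r_j = dim_{𝔽_p} (Γ j / Γ (j + 1))`. -/
noncomputable def pDegree (p : ℕ) [Fact p.Prime] (G : Type*) [Group G] (j : ℕ) : ℕ :=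
  Module.finrank (ZMod p) (Additive (PLayer p G j))

/-- The length of the `p`-lower central series: the least `ℓ` with `Γ (ℓ + 1) = 1` (one exists
for every finite `p`-group). -/
noncomputable def pLength (p : ℕ) (G : Type*) [Group G] : ℕ :=
  sInf {l | pLowerCentralSeries p G (l + 1) = ⊥}

/-- `δ_G = (∑ j r_j)² / ∑ j² r_j`, the sums being over `1 ≤ j ≤ ℓ`. For the trivial group this
is `0`. -/
noncomputable def pDelta (p : ℕ) [Fact p.Prime] (G : Type*) [Group G] : ℝ :=
  (∑ j ∈ Finset.Icc 1 (pLength p G), (j : ℝ) * (pDegree p G j : ℝ)) ^ 2 /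
    ∑ j ∈ Finset.Icc 1 (pLength p G), (j : ℝ) ^ 2 * (pDegree p G j : ℝ)

/-! ### Slice rank of a tensor with a triangular coordinate expansion -/

/-! The group algebra has a basis adapted to the filtration `Γ`. Choose elements `g_s ∈ Γ_{w_s}`
refining `Γ` in steps of index `p`; the products of the powers `(g_s - 1)^{a_s}`, `0 ≤ a_s < p`,
taken in a fixed order and weighted by `∑ a_s w_s`, form a basis (Jennings). The span of the basis
elements of weight at least `k` is a multiplicative filtration, so the structure constant at `(i, j,
k)` vanishes unless `wt k ≥ wt i + wt j`.

Let `W = (p - 1) ∑ j r_j` be the top weight. A nonzero structure constant has `wt i ≤ W/3`, `wt j ≤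
W/3` or `wt k ≥ 2W/3`, so the slice rank is at most twice the number of light basis elements plus
the number of heavy ones (`sliceRank_le_of_expansion`). For a uniformly random basis element the
`a_s` are independent and uniform, so the weight has mean `W/2`, and Hoeffding's inequality bounds
each tail by `exp(-W² / (18 S))` with `S = (p - 1)² ∑ j² r_j`. The factor `(p - 1)²` cancels and `W²
/ S = δ_G`.

Multiplicativity is proved by adjoining one `g_s` at a time, from the bottom of the filtration up
(`IsWeightedSpan.extend`). The induction also carries the effect of conjugation on weights, which is
what allows a new factor `g_s - 1` to be moved past the old ones. -/

theorem HasSliceDecomposition.of_fintype {𝕜 X Y Z α β γ : Type*} [Field 𝕜]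
    [Fintype α] [Fintype β] [Fintype γ] {F : X → Y → Z → 𝕜}
    (f₁ : α → X → Y → 𝕜) (g₁ : α → Z → 𝕜) (f₂ : β → X → Z → 𝕜) (g₂ : β → Y → 𝕜)
    (f₃ : γ → Y → Z → 𝕜) (g₃ : γ → X → 𝕜)
    (h : ∀ x y z, F x y z =
      ∑ i, f₁ i x y * g₁ i z + ∑ i, f₂ i x z * g₂ i y + ∑ i, f₃ i y z * g₃ i x) :
    HasSliceDecomposition F (Fintype.card α + Fintype.card β + Fintype.card γ) := by
  refine ⟨_, _, _, rfl, fun i => f₁ ((Fintype.equivFin α).symm i),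
    fun i => g₁ ((Fintype.equivFin α).symm i), fun i => f₂ ((Fintype.equivFin β).symm i),
    fun i => g₂ ((Fintype.equivFin β).symm i), fun i => f₃ ((Fintype.equivFin γ).symm i),
    fun i => g₃ ((Fintype.equivFin γ).symm i), fun x y z => ?_⟩
  rw [h, (Fintype.equivFin α).symm.sum_comp (fun i => f₁ i x y * g₁ i z),
    (Fintype.equivFin β).symm.sum_comp (fun i => f₂ i x z * g₂ i y),
    (Fintype.equivFin γ).symm.sum_comp (fun i => f₃ i y z * g₃ i x)]

theorem sliceRank_le_card {𝕜 X Y Z : Type*} [Field 𝕜] [Finite Z] (F : X → Y → Z → 𝕜) :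
    sliceRank F ≤ Nat.card Z := by
  classical
  have := Fintype.ofFinite Z
  rw [Nat.card_eq_fintype_card]
  refine Nat.sInf_le (s := {r | HasSliceDecomposition F r}) ?_
  simpa using HasSliceDecomposition.of_fintype (α := Z) (β := Empty) (γ := Empty)
    (F := F) (fun i x y => F x y i) (fun i z => if z = i then 1 else 0) Empty.elim Empty.elim
    Empty.elim Empty.elim (by intro x y z; simp)

/-- If a tensor is obtained by changes of coordinates from `t`, and every nonzero entry `t i j k`
has `i ∈ P`, `j ∈ P` or `k ∈ Q`, then its slice rank is at most `2 |P| + |Q|`. -/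
theorem sliceRank_le_of_expansion {𝕜 X Y Z ι : Type*} [Field 𝕜] [Fintype ι] [DecidableEq ι]
    (F : X → Y → Z → 𝕜) (t : ι → ι → ι → 𝕜) (c : ι → X → 𝕜) (d : ι → Y → 𝕜) (b : ι → Z → 𝕜)
    (hF : ∀ x y z, F x y z = ∑ i, ∑ j, ∑ k, c i x * d j y * t i j k * b k z)
    (P Q : Finset ι) (ht : ∀ i j k, i ∉ P → j ∉ P → k ∉ Q → t i j k = 0) :
    sliceRank F ≤ Q.card + P.card + P.card := by
  refine Nat.sInf_le (s := {r | HasSliceDecomposition F r}) ?_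
  have := HasSliceDecomposition.of_fintype (α := Q) (β := P) (γ := P) (F := F)
    (fun k x y => ∑ i ∈ Pᶜ, ∑ j ∈ Pᶜ, c i x * d j y * t i j k) (fun k z => b k z)
    (fun j x z => ∑ i ∈ Pᶜ, ∑ k, c i x * t i j k * b k z) (fun j y => d j y)
    (fun i y z => ∑ j, ∑ k, d j y * t i j k * b k z) (fun i x => c i x) (by
      intro x y z
      have h1 := Finset.sum_coe_sort Q
        (fun k => (∑ i ∈ Pᶜ, ∑ j ∈ Pᶜ, c i x * d j y * t i j k) * b k z)
      have h2 := Finset.sum_coe_sort P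
        (fun j => (∑ i ∈ Pᶜ, ∑ k, c i x * t i j k * b k z) * d j y)
      have h3 := Finset.sum_coe_sort P
        (fun i => (∑ j, ∑ k, d j y * t i j k * b k z) * c i x)
      -- Each term is assigned to one slice: to the `x`-slices if `i ∈ P`, otherwise to the
      -- `y`-slices if `j ∈ P`, otherwise to the `z`-slices; `ht` kills what remains.
      rw [h1, h2, h3, hF, ← Finset.sum_add_sum_compl P, add_comm]
      congr 1
      · have hsplit : ∀ i ∈ Pᶜ, ∑ j, ∑ k, c i x * d j y * t i j k * b k z =
            ∑ j ∈ P, (∑ k, c i x * t i j k * b k z) * d j y +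
            ∑ k ∈ Q, (∑ j ∈ Pᶜ, c i x * d j y * t i j k) * b k z := by
          intro i hi
          rw [← Finset.sum_add_sum_compl P]
          congr 1
          · refine Finset.sum_congr rfl fun j _ => ?_
            rw [Finset.sum_mul]
            exact Finset.sum_congr rfl fun k _ => by ring
          · rw [Finset.sum_comm, ← Finset.sum_add_sum_compl Q, add_eq_left.2]
            · exact Finset.sum_congr rfl fun k _ => by rw [Finset.sum_mul]
            · refine Finset.sum_eq_zero fun k hk => Finset.sum_eq_zero fun j hj => ?_
              rw [ht i j k (Finset.mem_compl.1 hi) (Finset.mem_compl.1 hj) (Finset.mem_compl.1 hk)]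
              ring
        rw [Finset.sum_congr rfl hsplit, Finset.sum_add_distrib, add_comm, Finset.sum_comm,
          Finset.sum_comm (s := Pᶜ) (t := P)]
        simp only [Finset.sum_mul]
      · refine Finset.sum_congr rfl fun i _ => ?_
        simp only [Finset.sum_mul]
        exact Finset.sum_congr rfl fun j _ => Finset.sum_congr rfl fun k _ => by ring)
  simpa using this

/-- Slice rank of a group multiplication tensor, from a basis of the group algebra whose structure
constants `b i * b j = ∑ k, t i j k • b k` vanish off `i ∈ P`, `j ∈ P`, `k ∈ Q`. -/
theorem sliceRank_groupMulTensor_le {𝕜 G ι : Type*} [Field 𝕜] [Group G] [Finite G] [Fintype ι]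
    [DecidableEq ι] (b : Module.Basis ι 𝕜 (MonoidAlgebra 𝕜 G)) (P Q : Finset ι)
    (h : ∀ i j k, i ∉ P → j ∉ P → k ∉ Q → b.repr (b i * b j) k = 0) :
    sliceRank (groupMulTensor 𝕜 G) ≤ Q.card + P.card + P.card := by
  set s := MonoidAlgebra.basis G 𝕜
  refine sliceRank_le_of_expansion _ (fun i j k => b.repr (b i * b j) k)
    (fun i x => b.repr (s x) i) (fun i x => b.repr (s x) i) (fun k z => s.repr (b k) z)
    (fun x y z => ?_) P Q h
  have hxy : s x * s y = ∑ i, ∑ j, ∑ k,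
      (b.repr (s x) i * b.repr (s y) j * b.repr (b i * b j) k) • b k := by
    conv_lhs => rw [← b.sum_repr (s x), ← b.sum_repr (s y)]
    rw [Finset.sum_mul]
    refine Finset.sum_congr rfl fun i _ => ?_
    rw [Finset.mul_sum]
    refine Finset.sum_congr rfl fun j _ => ?_
    rw [smul_mul_smul_comm]
    conv_lhs => rw [← b.sum_repr (b i * b j), Finset.smul_sum]
    simp only [smul_smul]
  change s.repr (s x * s y) z = _
  rw [hxy]
  simp [map_sum, Finsupp.finsetSum_apply]

/-! ### Exponential moments and tails -/

/-- Hoeffding's lemma for a uniform digit: the symmetry `a ↦ p - 1 - a` replaces `exp` by `cosh`,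
then `cosh t ≤ exp (t² / 2)` and `|a - (p - 1)/2| ≤ (p - 1)/2`. -/
theorem sum_exp_mul_sub_half_le (p w : ℕ) (x : ℝ) :
    ∑ a : Fin p, Real.exp (x * ((a : ℕ) * w - ((p : ℝ) - 1) * w / 2)) ≤
      p * Real.exp (x ^ 2 * (((p : ℝ) - 1) ^ 2 * (w : ℝ) ^ 2) / 8) := by
  have hrev : ∑ a : Fin p, Real.exp (x * ((a : ℕ) * w - ((p : ℝ) - 1) * w / 2)) =
      ∑ a : Fin p, Real.exp (-(x * ((a : ℕ) * w - ((p : ℝ) - 1) * w / 2))) := by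
    rw [← Equiv.sum_comp Fin.revPerm]
    refine Finset.sum_congr rfl fun a _ => ?_
    have : ((Fin.revPerm a : Fin p) : ℕ) + (a : ℕ) + 1 = p := by
      simp only [Fin.revPerm_apply, Fin.val_rev]; omega
    have h' : (((Fin.revPerm a : Fin p) : ℕ) : ℝ) = p - 1 - (a : ℕ) := by
      have := congrArg (Nat.cast : ℕ → ℝ) this
      push_cast at this
      linarith
    rw [h']
    congr 1
    ring
  have hcosh : ∑ a : Fin p, Real.exp (x * ((a : ℕ) * w - ((p : ℝ) - 1) * w / 2)) =
      ∑ a : Fin p, Real.cosh (x * ((a : ℕ) * w - ((p : ℝ) - 1) * w / 2)) := by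
    simp only [Real.cosh_eq, ← Finset.sum_div, Finset.sum_add_distrib, ← hrev]
    ring
  rw [hcosh]
  calc _ ≤ ∑ _a : Fin p, Real.exp (x ^ 2 * (((p : ℝ) - 1) ^ 2 * (w : ℝ) ^ 2) / 8) := by
        refine Finset.sum_le_sum fun a _ => (Real.cosh_le_exp_half_sq _).trans ?_
        refine Real.exp_le_exp.2 ?_
        have ha0 : (0 : ℝ) ≤ (a : ℕ) := Nat.cast_nonneg _
        have ha1 : ((a : ℕ) : ℝ) ≤ p - 1 := by
          have : ((a : ℕ) : ℝ) + 1 ≤ p := by exact_mod_cast a.2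
          linarith
        have h4 : (((a : ℕ) : ℝ) - (p - 1) / 2) ^ 2 ≤ ((p - 1) / 2) ^ 2 := by nlinarith
        have h5 := mul_le_mul_of_nonneg_left h4 (by positivity : 0 ≤ x ^ 2 * (w : ℝ) ^ 2)
        linarith
    _ = _ := by simp

/-- Chernoff bound for both tails from a Gaussian bound on the exponential moments. -/
theorem card_le_of_sum_exp_le {ι : Type*} [Fintype ι] (f : ι → ℝ) (C W S : ℝ) (hW : 0 ≤ W)
    (hS : 0 ≤ S) (h : ∀ x : ℝ, ∑ i, Real.exp (x * f i) ≤ C * Real.exp (x ^ 2 * S / 8))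
    (P : Finset ι) (hP : ∀ i ∈ P, W / 6 ≤ f i) :
    (P.card : ℝ) ≤ C * Real.exp (-(W ^ 2 / S) / 18) := by
  -- The minimiser of `x² S / 8 - x W / 6`. If `S = 0`, division by zero gives `x = 0` and both
  -- exponents are `0`.
  set x := 2 * W / (3 * S)
  have hx : 0 ≤ x := by positivity
  have h1 : (P.card : ℝ) * Real.exp (x * (W / 6)) ≤ C * Real.exp (x ^ 2 * S / 8) := by
    refine le_trans ?_ (h x)
    calc (P.card : ℝ) * Real.exp (x * (W / 6)) = ∑ _i ∈ P, Real.exp (x * (W / 6)) := by simp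
      _ ≤ ∑ i ∈ P, Real.exp (x * f i) := Finset.sum_le_sum fun i hi =>
          Real.exp_le_exp.2 (mul_le_mul_of_nonneg_left (hP i hi) hx)
      _ ≤ ∑ i, Real.exp (x * f i) := Finset.sum_le_univ_sum_of_nonneg fun i => (Real.exp_pos _).le
  rw [← le_div_iff₀ (Real.exp_pos _), mul_div_assoc, ← Real.exp_sub] at h1
  have hexp : x ^ 2 * S / 8 - x * (W / 6) = -(W ^ 2 / S) / 18 := by
    rcases hS.eq_or_lt with hS0 | hS0
    · simp [x, ← hS0]
    · simp only [x]
      field_simp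
      ring
  rwa [hexp] at h1

/-! ### Weighted spanning families -/

/-- The span of the members of weight at least `k` of a weighted family. -/
def weightSpan (K : Type*) {A ι : Type*} [CommRing K] [Ring A] [Algebra K A] (e : ι → A)
    (wt : ι → ℕ) (k : ℕ) : Submodule K A :=
  Submodule.span K (e '' {i | k ≤ wt i})

/-- For a representation `ρ : G → A` of a group with a filtration `N`, the weighted family `e`
spans a multiplicative filtration that contains `ρ h - 1` at level `m` for `h ∈ H ∩ N m`, and on
which conjugation by elements of `N u` acts trivially up to a shift by `u`. -/
structure IsWeightedSpan (K : Type*) {G A ι : Type*} [Group G] [CommRing K] [Ring A] [Algebra K A]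
    (ρ : G →* A) (N : ℕ → Subgroup G) (H : Subgroup G) (e : ι → A) (wt : ι → ℕ) : Prop where
  one_mem : 1 ∈ weightSpan K e wt 0
  mul_mem : ∀ {k l : ℕ} {u v : A}, u ∈ weightSpan K e wt k → v ∈ weightSpan K e wt l →
    u * v ∈ weightSpan K e wt (k + l)
  sub_one_mem : ∀ {m : ℕ} {h : G}, h ∈ H → h ∈ N m → ρ h - 1 ∈ weightSpan K e wt m
  conj_sub_mem : ∀ {u : ℕ} {g : G}, 1 ≤ u → g ∈ N u → ∀ {m : ℕ} {v : A},
    v ∈ weightSpan K e wt m → ρ g⁻¹ * v * ρ g - v ∈ weightSpan K e wt (m + u)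

section WeightSpan

variable {K A ι : Type*} [CommRing K] [Ring A] [Algebra K A] {e : ι → A} {wt : ι → ℕ}

theorem weightSpan_antitone : Antitone (weightSpan K e wt) := fun _ _ h =>
  Submodule.span_mono (Set.image_mono fun _ hi => le_trans h hi)

theorem mem_weightSpan {i : ι} {k : ℕ} (h : k ≤ wt i) : e i ∈ weightSpan K e wt k :=
  Submodule.subset_span ⟨i, h, rfl⟩

/-- To map `weightSpan` linearly into a submodule it suffices to map the family. -/
theorem weightSpan_le_comap {B : Type*} [AddCommGroup B] [Module K B] {k : ℕ} (f : A →ₗ[K] B)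
    (S : Submodule K B) (h : ∀ i, k ≤ wt i → f (e i) ∈ S) {v : A}
    (hv : v ∈ weightSpan K e wt k) : f v ∈ S := by
  have : weightSpan K e wt k ≤ S.comap f := by
    refine Submodule.span_le.2 ?_
    rintro _ ⟨i, hi, rfl⟩
    exact h i hi
  exact this hv

/-- The family `(a, i) ↦ x ^ a * e i` for `a < p`. -/
def powFamily (p : ℕ) (x : A) (e : ι → A) : Fin p × ι → A := fun i => x ^ (i.1 : ℕ) * e i.2

/-- The weight of `x ^ a * e i`, when `x` has weight `w`. -/
def powWeight (p w : ℕ) (wt : ι → ℕ) : Fin p × ι → ℕ := fun i => (i.1 : ℕ) * w + wt i.2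

theorem pow_mul_mem_powFamily {p w a k : ℕ} {x v : A} (ha : a < p)
    (hv : v ∈ weightSpan K e wt k) :
    x ^ a * v ∈ weightSpan K (powFamily p x e) (powWeight p w wt) (a * w + k) := by
  refine weightSpan_le_comap (LinearMap.mulLeft K (x ^ a)) _ (fun i hi => ?_) hv
  exact mem_weightSpan (e := powFamily p x e) (wt := powWeight p w wt) (i := (⟨a, ha⟩, i))
    (by simp only [powWeight]; omega)

end WeightSpan

/-! ### Adjoining one element to a weighted span -/

section Step

variable {K G A ι : Type*} [Group G] [CommRing K] [Ring A] [Algebra K A]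
  {ρ : G →* A} {N : ℕ → Subgroup G} {H' : Subgroup G} {e : ι → A} {wt : ι → ℕ}
  {p w : ℕ} {g : G}

/-- The filtration spanned by the powers of `ρ g - 1` times the family `e`. -/
local notation "V'" => weightSpan K (powFamily p (ρ g - 1) e) (powWeight p w wt)

theorem IsPFiltration.antitone (hN : IsPFiltration p N) : Antitone N := by
  refine antitone_nat_of_succ_le fun i => ?_
  rcases Nat.eq_zero_or_pos i with rfl | hi
  · rw [hN.zero]; exact le_top
  · exact hN.succ_le i hi

theorem weightSpan_le_powFamily (hp : 0 < p) {k : ℕ} {v : A} (hv : v ∈ weightSpan K e wt k) :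
    v ∈ V' k := by
  simpa using pow_mul_mem_powFamily (x := ρ g - 1) (w := w) hp hv

theorem IsWeightedSpan.powFamily_mul_mem (h : IsWeightedSpan K ρ N H' e wt) {k l : ℕ} {u v : A}
    (hu : u ∈ V' k) (hv : v ∈ weightSpan K e wt l) : u * v ∈ V' (k + l) := by
  refine weightSpan_le_comap (LinearMap.mulRight K v) _ (fun i hi => ?_) hu
  have := pow_mul_mem_powFamily (p := p) (w := w) (x := ρ g - 1) i.1.2
    (h.mul_mem (mem_weightSpan (K := K) (e := e) (wt := wt) (le_refl (wt i.2))) hv)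
  simp only [LinearMap.mulRight_apply, powFamily, mul_assoc]
  refine weightSpan_antitone ?_ this
  simp only [powWeight] at hi
  omega

/-- Left multiplication raises the exponent by one. Only `a = p - 1` overflows, and there `(ρ g -
1)^p = ρ (g^p) - 1` in characteristic `p`, an old element of weight `w * p`. -/
theorem IsWeightedSpan.mul_powFamily_mem [Fact p.Prime] [CharP A p]
    (h : IsWeightedSpan K ρ N H' e wt) (hgp : g ^ p ∈ H') (hgp' : g ^ p ∈ N (w * p)) {k : ℕ} {u : A}
    (hu : u ∈ V' k) : (ρ g - 1) * u ∈ V' (w + k) := by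
  have hp : 0 < p := (Fact.out : p.Prime).pos
  refine weightSpan_le_comap (LinearMap.mulLeft K (ρ g - 1)) _ (fun i hi => ?_) hu
  simp only [LinearMap.mulLeft_apply, powFamily, ← mul_assoc, ← pow_succ']
  simp only [powWeight] at hi
  have hi2 := mem_weightSpan (K := K) (e := e) (wt := wt) (le_refl (wt i.2))
  rcases lt_or_eq_of_le (Nat.succ_le_of_lt i.1.2) with hlt | heq
  · refine weightSpan_antitone ?_ (pow_mul_mem_powFamily (w := w) hlt hi2)
    rw [Nat.succ_mul]; omega
  · have hpow : (ρ g - 1) ^ ((i.1 : ℕ) + 1) = ρ (g ^ p) - 1 := by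
      rw [show (i.1 : ℕ) + 1 = p from heq, sub_pow_char_of_commute _ (Commute.one_right _), one_pow,
        map_pow]
    rw [hpow]
    refine weightSpan_le_powFamily hp (weightSpan_antitone ?_
      (h.mul_mem (h.sub_one_mem hgp hgp') hi2))
    rw [show w * p = (i.1 : ℕ) * w + w by rw [← Nat.succ_mul, heq, mul_comm]]
    omega

/-- Old elements multiply well on the right and `ρ g - 1` on the left, so it remains to move `ρ g -
1` leftwards past old elements; the conjugation property controls the error. -/
theorem IsWeightedSpan.extend_mul_mem [Fact p.Prime] [CharP A p]
    (h : IsWeightedSpan K ρ N H' e wt) (hgp : g ^ p ∈ H') (hgpN : g ^ p ∈ N (w * p))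
    (hw : 1 ≤ w) (hgw : g ∈ N w) {k l : ℕ} {u v : A} (hu : u ∈ V' k) (hv : v ∈ V' l) :
    u * v ∈ V' (k + l) := by
  have hp0 : 0 < p := (Fact.out : p.Prime).pos
  have hmono : ∀ {k : ℕ} {v : A}, v ∈ weightSpan K e wt k → v ∈ V' k :=
    fun hv => weightSpan_le_powFamily hp0 hv
  have hanti : ∀ {k l : ℕ} {v : A}, k ≤ l → v ∈ V' l → v ∈ V' k :=
    fun hkl hv => weightSpan_antitone hkl hv
  have hleft : ∀ {k : ℕ} {u : A}, u ∈ V' k → (ρ g - 1) * u ∈ V' (w + k) :=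
    fun hu => h.mul_powFamily_mem hgp hgpN hu
  have hleft_pow : ∀ (a : ℕ) {k : ℕ} {u : A}, u ∈ V' k → (ρ g - 1) ^ a * u ∈ V' (a * w + k) := by
    intro a
    induction a with
    | zero => intro k u hu; simpa using hu
    | succ a ih =>
      intro k u hu
      rw [pow_succ', mul_assoc]
      refine hanti ?_ (hleft (ih hu))
      rw [Nat.succ_mul]; omega
  have hright_old : ∀ {k : ℕ} {v : A}, v ∈ weightSpan K e wt k → v * (ρ g - 1) ∈ V' (k + w) := by
    intro k v hv
    have h1 := h.conj_sub_mem hw hgw hv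
    have h2 : ρ g⁻¹ * v * ρ g ∈ weightSpan K e wt k := by
      have := add_mem (weightSpan_antitone (Nat.le_add_right k w) h1) hv
      rwa [sub_add_cancel] at this
    have h3 := add_mem (hanti (le_of_eq (add_comm k w)) (hleft (hmono h2))) (hmono h1)
    -- The commutation rule: the conjugate of `v` has the same weight as `v`, and the correction
    -- gains `w`.
    have h4 : (ρ g - 1) * (ρ g⁻¹ * v * ρ g) + (ρ g⁻¹ * v * ρ g - v) = v * (ρ g - 1) := by
      have : ρ g * ρ g⁻¹ = 1 := by rw [← map_mul, mul_inv_cancel, map_one]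
      rw [sub_mul, one_mul, ← mul_assoc, ← mul_assoc, this, one_mul, mul_sub, mul_one]
      abel
    rwa [h4] at h3
  have hright : ∀ {k : ℕ} {v : A}, v ∈ V' k → v * (ρ g - 1) ∈ V' (k + w) := by
    intro k v hv
    refine weightSpan_le_comap (LinearMap.mulRight K (ρ g - 1)) _ (fun i hi => ?_) hv
    simp only [LinearMap.mulRight_apply, powFamily, mul_assoc]
    refine hanti ?_ (hleft_pow i.1 (hright_old (mem_weightSpan (le_refl (wt i.2)))))
    simp only [powWeight] at hi
    omega
  have hright_pow : ∀ (a : ℕ) {k : ℕ} {v : A}, v ∈ V' k →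
      v * (ρ g - 1) ^ a ∈ V' (k + a * w) := by
    intro a
    induction a with
    | zero => intro k u hu; simpa using hu
    | succ a ih =>
      intro k u hu
      rw [pow_succ, ← mul_assoc]
      refine hanti ?_ (hright (ih hu))
      rw [Nat.succ_mul]; omega
  refine weightSpan_le_comap (LinearMap.mulLeft K u) _ (fun i hi => ?_) hv
  simp only [LinearMap.mulLeft_apply, powFamily, ← mul_assoc]
  refine hanti ?_ (h.powFamily_mul_mem (hright_pow i.1 hu) (mem_weightSpan (le_refl (wt i.2))))
  simp only [powWeight] at hi
  omega

theorem IsWeightedSpan.extend [Fact p.Prime] [CharP A p] (hN : IsPFiltration p N)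
    (h : IsWeightedSpan K ρ N H' e wt) {H : Subgroup G} (hw : 1 ≤ w) (hle : N (w + 1) ≤ H')
    (hH' : H' ≤ N w) (hgw : g ∈ N w)
    (hH : ∀ x ∈ H, ∃ a : ℕ, ∃ y ∈ H', x = g ^ a * y) :
    IsWeightedSpan K ρ N H (powFamily p (ρ g - 1) e) (powWeight p w wt) := by
  have hp : p.Prime := Fact.out
  have hp0 : 0 < p := hp.pos
  have hgpN : g ^ p ∈ N (w * p) := hN.pow_mem w hw g hgw
  have hgp : g ^ p ∈ H' := by
    refine hle (hN.antitone ?_ hgpN)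
    nlinarith [hp.two_le]
  have hmono : ∀ {k : ℕ} {v : A}, v ∈ weightSpan K e wt k → v ∈ V' k :=
    fun hv => weightSpan_le_powFamily hp0 hv
  have hanti : ∀ {k l : ℕ} {v : A}, k ≤ l → v ∈ V' l → v ∈ V' k :=
    fun hkl hv => weightSpan_antitone hkl hv
  have hleft : ∀ {k : ℕ} {u : A}, u ∈ V' k → (ρ g - 1) * u ∈ V' (w + k) :=
    fun hu => h.mul_powFamily_mem hgp hgpN hu
  have hleft_pow : ∀ (a : ℕ) {k : ℕ} {u : A}, u ∈ V' k → (ρ g - 1) ^ a * u ∈ V' (a * w + k) := by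
    intro a
    induction a with
    | zero => intro k u hu; simpa using hu
    | succ a ih =>
      intro k u hu
      rw [pow_succ', mul_assoc]
      refine hanti ?_ (hleft (ih hu))
      rw [Nat.succ_mul]; omega
  have hgleft : ∀ {k : ℕ} {u : A}, u ∈ V' k → ρ g * u ∈ V' k := by
    intro k u hu
    have := add_mem (hanti (Nat.le_add_left k w) (hleft hu)) hu
    rwa [sub_mul, one_mul, sub_add_cancel] at this
  have hmul : ∀ {k l : ℕ} {u v : A}, u ∈ V' k → v ∈ V' l → u * v ∈ V' (k + l) :=
    fun hu hv => h.extend_mul_mem hgp hgpN hw hgw hu hv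
  have hone : (1 : A) ∈ V' 0 := hmono h.one_mem
  have hx : ρ g - 1 ∈ V' w := by simpa using hleft hone
  have hxpow : ∀ a : ℕ, (ρ g - 1) ^ a ∈ V' (a * w) := fun a => by simpa using hleft_pow a hone
  refine ⟨hone, hmul, ?_, ?_⟩
  · intro m x hxH hxm
    by_cases hx' : x ∈ H'
    · exact hmono (h.sub_one_mem hx' hxm)
    -- An element outside `H'` is not in `N (w + 1)`, so weight `w` suffices for it.
    have hmw : m ≤ w := by
      by_contra hlt
      exact hx' (hle (hN.antitone (by omega) hxm))
    obtain ⟨a, y, hy, rfl⟩ := hH x hxH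
    have hy1 : ρ y - 1 ∈ V' w := hmono (h.sub_one_mem hy (hH' hy))
    have hy0 : ρ y ∈ V' 0 := by
      have := add_mem (hanti (Nat.zero_le w) hy1) hone
      rwa [sub_add_cancel] at this
    have hga : ∀ a : ℕ, ρ (g ^ a) - 1 ∈ V' w := by
      intro a
      induction a with
      | zero => simp
      | succ a ih =>
        have := add_mem (hgleft ih) hx
        rwa [mul_sub, mul_one, ← map_mul, ← pow_succ', sub_add_sub_cancel] at this
    have := hanti hmw (add_mem (hmul (k := w) (l := 0) (hga a) hy0) hy1)
    rwa [sub_mul, one_mul, ← map_mul, sub_add_sub_cancel] at this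
  · intro u g' hu hg' m v hv
    have hinv : ρ g' * ρ g'⁻¹ = 1 := by rw [← map_mul, mul_inv_cancel, map_one]
    have hconj_mul : ∀ a b : A, ρ g'⁻¹ * (a * b) * ρ g' =
        (ρ g'⁻¹ * a * ρ g') * (ρ g'⁻¹ * b * ρ g') := by
      intro a b
      have h1 : (ρ g'⁻¹ * a * ρ g') * (ρ g'⁻¹ * b * ρ g') =
          ρ g'⁻¹ * a * (ρ g' * ρ g'⁻¹) * b * ρ g' := by simp only [mul_assoc]
      rw [h1, hinv, mul_one]
      simp only [mul_assoc]
    -- A twisted Leibniz rule for conjugation `c`: `c(ab) - ab = c(a)(c(b) - b) + (c(a) - a)b`. It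
    -- reduces the claim to the single factor `ρ g - 1` and to old elements.
    have hsplit : ∀ {k l : ℕ} {a b : A}, a ∈ V' k → b ∈ V' l →
        ρ g'⁻¹ * a * ρ g' - a ∈ V' (k + u) → ρ g'⁻¹ * b * ρ g' - b ∈ V' (l + u) →
        ρ g'⁻¹ * (a * b) * ρ g' - a * b ∈ V' (k + l + u) := by
      intro k l a b ha hb ha' hb'
      have ha'' : ρ g'⁻¹ * a * ρ g' ∈ V' k := by
        have := add_mem (hanti (Nat.le_add_right k u) ha') ha
        rwa [sub_add_cancel] at this
      have h1 := add_mem (hmul ha'' hb') (hanti (by omega : k + (l + u) ≤ _) (hmul ha' hb))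
      rw [mul_sub, sub_mul, sub_add_sub_cancel, ← hconj_mul] at h1
      exact hanti (by omega) h1
    -- The difference is `ρ g` times `ρ c - 1` for a commutator `c ∈ N (w + u)`, which lies in `H'`
    -- because `u ≥ 1`.
    have hxc : ρ g'⁻¹ * (ρ g - 1) * ρ g' - (ρ g - 1) ∈ V' (w + u) := by
      have hc : g⁻¹ * g'⁻¹ * g * g' ∈ N (w + u) := by
        simpa [commutatorElement_def] using Subgroup.commutator_le.1
          (hN.commutator_le w u hw hu) _ (inv_mem hgw) _ (inv_mem hg')
      have h1 := hgleft (hmono (h.sub_one_mem (hle (hN.antitone (by omega) hc)) hc))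
      have hinv' : ρ g'⁻¹ * ρ g' = 1 := by rw [← map_mul, inv_mul_cancel, map_one]
      have h2 : ρ g * (ρ (g⁻¹ * g'⁻¹ * g * g') - 1) = ρ g'⁻¹ * (ρ g - 1) * ρ g' - (ρ g - 1) := by
        rw [mul_sub, ← map_mul, mul_sub, sub_mul, mul_one, mul_one, hinv', ← map_mul, ← map_mul]
        simp [mul_assoc]
      rwa [h2] at h1
    have hxca : ∀ a : ℕ, ρ g'⁻¹ * (ρ g - 1) ^ a * ρ g' - (ρ g - 1) ^ a ∈ V' (a * w + u) := by
      intro a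
      induction a with
      | zero => simp [← map_mul]
      | succ a ih =>
        rw [pow_succ, Nat.succ_mul]
        exact hsplit (hxpow a) hx ih hxc
    have key := weightSpan_le_comap (v := v) (k := m) (K := K)
      (LinearMap.mulRight K (ρ g') ∘ₗ LinearMap.mulLeft K (ρ g'⁻¹) - LinearMap.id) (V' (m + u))
      (fun i hi => ?_) hv
    · simpa using key
    · have h1 := hsplit (hxpow i.1) (hmono (mem_weightSpan (le_refl (wt i.2)))) (hxca i.1)
        (hmono (h.conj_sub_mem hu hg' (mem_weightSpan (le_refl (wt i.2)))))
      simp only [powWeight] at hi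
      exact hanti (by omega) h1

end Step

/-! ### Climbing the filtration from the trivial subgroup to the whole group -/

section Chain

variable {K G A : Type*} [Group G] [CommRing K] [Ring A] [Algebra K A]
  {ρ : G →* A} {N : ℕ → Subgroup G} {p : ℕ}

/-- A weighted spanning family indexed by a set of size `|H|`, whose weights have the exponential
moments of a random variable that is subgaussian about `W / 2` with variance proxy `S / 4`. -/
def HasWeightedFamily (K : Type*) {G A : Type*} [Group G] [CommRing K] [Ring A] [Algebra K A]
    (ρ : G →* A) (N : ℕ → Subgroup G) (H : Subgroup G) (W S : ℝ) : Prop :=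
  ∃ (ι : Type) (_ : Fintype ι) (e : ι → A) (wt : ι → ℕ), IsWeightedSpan K ρ N H e wt ∧
    Fintype.card ι = Nat.card H ∧
    ∀ x : ℝ, ∑ i, Real.exp (x * (wt i - W / 2)) ≤ Nat.card H * Real.exp (x ^ 2 * S / 8)

theorem hasWeightedFamily_bot : HasWeightedFamily K ρ N ⊥ 0 0 := by
  refine ⟨Unit, inferInstance, fun _ => 1, fun _ => 0, ?_, by simp, by simp⟩
  have hzero : ∀ {k : ℕ} {v : A}, k ≠ 0 →
      v ∈ weightSpan K (fun _ : Unit => (1 : A)) (fun _ => 0) k → v = 0 := by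
    intro k v hk hv
    simpa [weightSpan, hk] using hv
  have hscalar : ∀ {k : ℕ} {v : A},
      v ∈ weightSpan K (fun _ : Unit => (1 : A)) (fun _ => 0) k → ∃ c : K, c • (1 : A) = v := by
    intro k v hv
    have hv' := weightSpan_antitone (Nat.zero_le k) hv
    simpa [weightSpan, Submodule.mem_span_singleton] using hv'
  refine ⟨mem_weightSpan (e := fun _ : Unit => (1 : A)) (i := ()) le_rfl, ?_, ?_, ?_⟩
  · intro k l u v hu hv
    rcases Nat.eq_zero_or_pos l with rfl | hl
    · obtain ⟨c, rfl⟩ := hscalar hv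
      rw [mul_smul_comm, mul_one]
      exact Submodule.smul_mem _ _ hu
    · rw [hzero hl.ne' hv, mul_zero]
      exact Submodule.zero_mem _
  · intro m h hh _
    rw [Subgroup.mem_bot.1 hh, map_one, sub_self]
    exact Submodule.zero_mem _
  · intro u g _ _ m v hv
    obtain ⟨c, rfl⟩ := hscalar hv
    simp [← map_mul]

theorem HasWeightedFamily.extend [Fact p.Prime] [CharP A p] (hN : IsPFiltration p N)
    {H H' : Subgroup G} {W S : ℝ} {w : ℕ} {g : G} (h : HasWeightedFamily K ρ N H' W S) (hw : 1 ≤ w)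
    (hle : N (w + 1) ≤ H') (hH' : H' ≤ N w) (hgw : g ∈ N w)
    (hH : ∀ x ∈ H, ∃ a : ℕ, ∃ y ∈ H', x = g ^ a * y) (hcard : Nat.card H = p * Nat.card H') :
    HasWeightedFamily K ρ N H (((p : ℝ) - 1) * w + W)
      (((p : ℝ) - 1) ^ 2 * (w : ℝ) ^ 2 + S) := by
  obtain ⟨ι, _, e, wt, he, hc, hexp⟩ := h
  refine ⟨Fin p × ι, inferInstance, powFamily p (ρ g - 1) e, powWeight p w wt,
    he.extend hN hw hle hH' hgw hH, by simp [hc, hcard], fun x => ?_⟩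
  -- The new exponent is independent of the old index, so the exponential moments multiply.
  have hprod : ∑ i, Real.exp (x * ((powWeight p w wt i : ℕ) - (((p : ℝ) - 1) * w + W) / 2)) =
      (∑ a : Fin p, Real.exp (x * ((a : ℕ) * w - ((p : ℝ) - 1) * w / 2))) *
        ∑ i, Real.exp (x * (wt i - W / 2)) := by
    rw [Fintype.sum_prod_type, Finset.sum_mul_sum]
    refine Finset.sum_congr rfl fun a _ => Finset.sum_congr rfl fun i _ => ?_
    rw [← Real.exp_add, powWeight]
    push_cast
    congr 1
    ring
  rw [hprod, hcard]
  refine (mul_le_mul (sum_exp_mul_sub_half_le p w x) (hexp x)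
    (Finset.sum_nonneg fun i _ => (Real.exp_pos _).le) (by positivity)).trans (le_of_eq ?_)
  rw [mul_mul_mul_comm, ← Real.exp_add]
  push_cast
  congr 2
  ring

/-- Between two consecutive terms of the filtration of a `p`-group one can climb in steps of
index `p`, each obtained by adjoining one element. -/
theorem IsPFiltration.exists_extension [Fact p.Prime] [Finite G] (hG : IsPGroup p G)
    (hN : IsPFiltration p N) {w : ℕ} (hw : 1 ≤ w) {H' : Subgroup G} (hle : N (w + 1) ≤ H')
    (hlt : H' < N w) : ∃ (g : G) (H : Subgroup G), g ∈ N w ∧ H ≤ N w ∧ H' ≤ H ∧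
      Nat.card H = p * Nat.card H' ∧ ∀ x ∈ H, ∃ a : ℕ, ∃ y ∈ H', x = g ^ a * y := by
  have hp : p.Prime := Fact.out
  obtain ⟨g, hgw, hg⟩ := SetLike.exists_of_lt hlt
  -- `N w / N (w + 1)` is central in `G / N (w + 1)`, since `N 1 = G`.
  have hnormal : H'.Normal := by
    refine ⟨fun x hx c => ?_⟩
    have hc : c * x * c⁻¹ * x⁻¹ ∈ H' := by
      refine hle (hN.antitone (by omega : w + 1 ≤ 1 + w) ?_)
      exact Subgroup.commutator_le.1 (hN.commutator_le 1 w le_rfl hw) c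
        (by rw [hN.one]; exact Subgroup.mem_top c) x (hlt.le hx)
    simpa using mul_mem hc hx
  have hgp : g ^ p ∈ H' := by
    refine hle (hN.antitone ?_ (hN.pow_mem w hw g hgw))
    nlinarith [hp.two_le]
  have hrep : ∀ x ∈ Subgroup.zpowers g ⊔ H', ∃ a : Fin p, ∃ y : H', g ^ (a : ℕ) * y = x := by
    intro x hx
    obtain ⟨z, ⟨k, rfl⟩, y, hy, rfl⟩ := Subgroup.mem_sup_of_normal_right.1 hx
    have hp0 : (p : ℤ) ≠ 0 := by exact_mod_cast hp.ne_zero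
    have hk0 := Int.emod_nonneg k hp0
    have hk1 := Int.emod_lt_of_pos k (by exact_mod_cast hp.pos : (0 : ℤ) < p)
    have hk := Int.emod_add_mul_ediv k p
    refine ⟨⟨(k % p).toNat, by omega⟩, ⟨(g ^ p) ^ (k / p) * y,
      mul_mem (zpow_mem hgp _) hy⟩, ?_⟩
    simp only [← mul_assoc]
    rw [← zpow_natCast g (k % p).toNat, Int.toNat_of_nonneg hk0, ← zpow_natCast g p, ← zpow_mul,
      ← zpow_add, hk]
  refine ⟨g, Subgroup.zpowers g ⊔ H', hgw, sup_le (by simpa using hgw) hlt.le, le_sup_right, ?_,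
    fun x hx => ?_⟩
  · set H := Subgroup.zpowers g ⊔ H'
    have hupper : Nat.card H ≤ p * Nat.card H' := by
      have := Nat.card_le_card_of_surjective
        (fun q : {q : Fin p × H' // g ^ (q.1 : ℕ) * (q.2 : G) ∈ H} =>
          (⟨g ^ (q.1.1 : ℕ) * (q.1.2 : G), q.2⟩ : H)) (by
          rintro ⟨x, hx⟩
          obtain ⟨a, y, rfl⟩ := hrep x hx
          exact ⟨⟨(a, y), hx⟩, rfl⟩)
      refine this.trans ((Nat.card_le_card_of_injective _ Subtype.val_injective).trans ?_)
      simp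
    obtain ⟨a, ha⟩ := IsPGroup.iff_card.1 (hG.to_subgroup H)
    obtain ⟨b, hb⟩ := IsPGroup.iff_card.1 (hG.to_subgroup H')
    have hltH : H' < H := lt_of_le_of_ne le_sup_right fun heq =>
      hg (heq ▸ (le_sup_left : _ ≤ H) (Subgroup.mem_zpowers g))
    have hcard : Nat.card H' < Nat.card H := by
      refine lt_of_le_of_ne (Subgroup.card_le_of_le hltH.le) fun heq => hltH.ne ?_
      exact Subgroup.eq_of_le_of_card_ge hltH.le heq.ge
    refine le_antisymm hupper ?_
    rw [ha, hb] at hcard ⊢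
    rw [← pow_succ']
    -- Both orders are powers of `p`, so strict inclusion already forces index at least `p`.
    exact Nat.pow_le_pow_right hp.pos ((Nat.pow_lt_pow_iff_right hp.one_lt).1 hcard)
  · obtain ⟨a, y, rfl⟩ := hrep x hx
    exact ⟨a, y, y.2, rfl⟩

theorem HasWeightedFamily.extend_layer [Fact p.Prime] [CharP A p] [Finite G] (hG : IsPGroup p G)
    (hN : IsPFiltration p N) {w r : ℕ} (hw : 1 ≤ w) (hr : Nat.card (N w) =
      p ^ r * Nat.card (N (w + 1))) {W S : ℝ} (h : HasWeightedFamily K ρ N (N (w + 1)) W S) :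
    HasWeightedFamily K ρ N (N w) (((p : ℝ) - 1) * (w * r) + W)
      (((p : ℝ) - 1) ^ 2 * ((w : ℝ) ^ 2 * r) + S) := by
  have hp : p.Prime := Fact.out
  have key : ∀ t ≤ r, ∃ H : Subgroup G, N (w + 1) ≤ H ∧ H ≤ N w ∧
      Nat.card H = p ^ t * Nat.card (N (w + 1)) ∧
      HasWeightedFamily K ρ N H (((p : ℝ) - 1) * (w * t) + W)
        (((p : ℝ) - 1) ^ 2 * ((w : ℝ) ^ 2 * t) + S) := by
    intro t
    induction t with
    | zero => exact fun _ => ⟨_, le_rfl, hN.succ_le w hw, by simp, by simpa using h⟩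
    | succ t ih =>
      intro ht
      obtain ⟨H', h1, h2, h3, h4⟩ := ih (by omega)
      have hlt : H' < N w := by
        refine lt_of_le_of_ne h2 fun heq => ?_
        rw [heq, hr] at h3
        have := Nat.pow_right_injective hp.two_le (Nat.eq_of_mul_eq_mul_right Nat.card_pos h3)
        omega
      obtain ⟨g, H, hg, hH, hH', hcard, hrep⟩ := hN.exists_extension hG hw h1 hlt
      refine ⟨H, h1.trans hH', hH, by rw [hcard, h3]; ring, ?_⟩
      convert h4.extend hN hw h1 h2 hg hrep hcard using 1 <;> push_cast <;> ring
  obtain ⟨H, -, h2, h3, h4⟩ := key r le_rfl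
  rwa [Subgroup.eq_of_le_of_card_ge h2 (by rw [h3, hr])] at h4

theorem IsPFiltration.hasWeightedFamily_top [Fact p.Prime] [CharP A p] [Finite G]
    (hG : IsPGroup p G) (hN : IsPFiltration p N) {l : ℕ} (hl : N (l + 1) = ⊥) (r : ℕ → ℕ)
    (hr : ∀ w, 1 ≤ w → Nat.card (N w) = p ^ r w * Nat.card (N (w + 1))) :
    HasWeightedFamily K ρ N ⊤ (((p : ℝ) - 1) * ∑ j ∈ Finset.Icc 1 l, (j : ℝ) * r j)
      (((p : ℝ) - 1) ^ 2 * ∑ j ∈ Finset.Icc 1 l, (j : ℝ) ^ 2 * r j) := by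
  -- Here `t` counts the layers already climbed from `N (l + 1) = ⊥`; `t = l` reaches `N 1`.
  have key : ∀ t ≤ l, HasWeightedFamily K ρ N (N (l - t + 1))
      (((p : ℝ) - 1) * ∑ j ∈ Finset.Icc (l - t + 1) l, (j : ℝ) * r j)
      (((p : ℝ) - 1) ^ 2 * ∑ j ∈ Finset.Icc (l - t + 1) l, (j : ℝ) ^ 2 * r j) := by
    intro t
    induction t with
    | zero =>
      intro _
      simpa [hl] using hasWeightedFamily_bot
    | succ t ih =>
      intro ht
      have hs : l - t = l - (t + 1) + 1 := by omega
      have h := ih (by omega)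
      rw [hs] at h
      have := h.extend_layer hG hN (Nat.succ_pos _) (hr _ (Nat.succ_pos _))
      rw [← mul_add, ← mul_add] at this
      rw [← Finset.add_sum_Ioc_eq_sum_Icc (a := l - (t + 1) + 1) (by omega),
        ← Finset.add_sum_Ioc_eq_sum_Icc (a := l - (t + 1) + 1) (by omega)]
      rwa [show Finset.Icc (l - (t + 1) + 1 + 1) l = Finset.Ioc (l - (t + 1) + 1) l by
        ext; simp] at this
  have := key l le_rfl
  rwa [Nat.sub_self, zero_add, hN.one] at this

end Chain

/-! ### From weighted families to the slice rank bound -/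

theorem natCard_pLowerCentralSeries (p : ℕ) [Fact p.Prime] (G : Type*) [Group G] [Finite G]
    (j : ℕ) (hj : 1 ≤ j) : Nat.card (pLowerCentralSeries p G j) =
      p ^ pDegree p G j * Nat.card (pLowerCentralSeries p G (j + 1)) := by
  have hle := (isPFiltration_pLowerCentralSeries p G).succ_le j hj
  rw [Subgroup.card_eq_card_quotient_mul_card_subgroup
    ((pLowerCentralSeries p G (j + 1)).subgroupOf (pLowerCentralSeries p G j)),
    Nat.card_congr (Subgroup.subgroupOfEquivOfLe hle).toEquiv]
  congr 1
  have : Finite (Additive (PLayer p G j)) := inferInstanceAs (Finite (PLayer p G j))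
  have h := Module.natCard_eq_pow_finrank (K := ZMod p) (V := Additive (PLayer p G j))
  rwa [Nat.card_zmod] at h

/-- The slice rank bound from a weighted family of total weight `W` spanning the group algebra. -/
theorem HasWeightedFamily.sliceRank_le {𝕜 G : Type*} [Field 𝕜] [Group G] [Finite G]
    {N : ℕ → Subgroup G} (hN : N 0 = ⊤) {W S : ℝ} (hW : 0 ≤ W) (hS : 0 ≤ S)
    (h : HasWeightedFamily 𝕜 (MonoidAlgebra.of 𝕜 G) N ⊤ W S) :
    (sliceRank (groupMulTensor 𝕜 G) : ℝ) ≤ 3 * Nat.card G * Real.exp (-(W ^ 2 / S) / 18) := by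
  classical
  obtain ⟨ι, _, e, wt, he, hcard, hexp⟩ := h
  rw [Subgroup.card_top] at hcard hexp
  have hspan0 : weightSpan 𝕜 e wt 0 = Submodule.span 𝕜 (Set.range e) := by
    simp [weightSpan]
  -- Every group element is `(g - 1) + 1`, of weight at least `0` because `N 0 = ⊤`. A spanning
  -- family of size `|G|` is then a basis.
  have htop : ⊤ ≤ Submodule.span 𝕜 (Set.range e) := by
    rw [← hspan0, ← (MonoidAlgebra.basis G 𝕜).span_eq, Submodule.span_le]
    rintro _ ⟨g, rfl⟩
    have := add_mem (he.sub_one_mem (m := 0) (Subgroup.mem_top g)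
      (by rw [hN]; exact Subgroup.mem_top g)) he.one_mem
    rw [sub_add_cancel] at this
    simpa using this
  have hfin : Fintype.card ι = Module.finrank 𝕜 (MonoidAlgebra 𝕜 G) := by
    rw [Module.finrank_eq_nat_card_basis (MonoidAlgebra.basis G 𝕜), hcard]
  set b := basisOfTopLeSpanOfCardEqFinrank e htop hfin
  have hb : ⇑b = e := coe_basisOfTopLeSpanOfCardEqFinrank e htop hfin
  have hcoeff : ∀ i j k, wt k < wt i + wt j → b.repr (b i * b j) k = 0 := by
    intro i j k hk
    have hm : b i * b j ∈ weightSpan 𝕜 e wt (wt i + wt j) := by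
      rw [hb]
      exact he.mul_mem (mem_weightSpan le_rfl) (mem_weightSpan le_rfl)
    rw [weightSpan, ← hb, b.mem_span_image] at hm
    by_contra hne
    exact absurd (hm (Finsupp.mem_support_iff.2 hne)) (not_le.2 hk)
  -- Off these sets `wt k < 2W/3 < wt i + wt j`; both thresholds lie at distance `W / 6` from the
  -- mean `W / 2`.
  set P := Finset.univ.filter fun i => (wt i : ℝ) ≤ W / 3
  set Q := Finset.univ.filter fun i => 2 * W / 3 ≤ (wt i : ℝ)
  have hrank := sliceRank_groupMulTensor_le b P Q (by
    intro i j k hi hj hk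
    simp only [P, Q, Finset.mem_filter, Finset.mem_univ, true_and, not_le] at hi hj hk
    refine hcoeff i j k ?_
    have : (wt k : ℝ) < wt i + wt j := by linarith
    exact_mod_cast this)
  have hP := card_le_of_sum_exp_le (fun i => W / 2 - (wt i : ℝ)) (Nat.card G) W S hW hS
    (fun x => by
      have := hexp (-x)
      rw [neg_sq] at this
      refine le_trans (le_of_eq (Finset.sum_congr rfl fun i _ => ?_)) this
      congr 1
      ring) P (by
    intro i hi
    simp only [P, Finset.mem_filter, Finset.mem_univ, true_and] at hi
    linarith)
  have hQ := card_le_of_sum_exp_le (fun i => (wt i : ℝ) - W / 2) (Nat.card G) W S hW hS hexp Q (by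
    intro i hi
    simp only [Q, Finset.mem_filter, Finset.mem_univ, true_and] at hi
    linarith)
  have : (sliceRank (groupMulTensor 𝕜 G) : ℝ) ≤ Q.card + P.card + P.card := by
    exact_mod_cast hrank
  linarith

theorem sliceRank_groupMulTensor_le_exp (p : ℕ) [Fact p.Prime] (n : ℕ) (G : Type*) [Group G]
    (hG : Nat.card G = p ^ n) : (sliceRank (groupMulTensor (ZMod p) G) : ℝ) ≤
      3 * (Nat.card G : ℝ) * Real.exp (-(pDelta p G) / 18) := by
  have hp : p.Prime := Fact.out
  have : Finite G := Nat.finite_of_card_ne_zero (by rw [hG]; exact pow_ne_zero _ hp.ne_zero)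
  have hN := isPFiltration_pLowerCentralSeries p G
  have hp1 : (0 : ℝ) < p - 1 := by
    have : (1 : ℝ) < p := by exact_mod_cast hp.one_lt
    linarith
  by_cases hne : {l | pLowerCentralSeries p G (l + 1) = ⊥}.Nonempty
  · have : CharP (MonoidAlgebra (ZMod p) G) p :=
      charP_of_injective_algebraMap (algebraMap (ZMod p) (MonoidAlgebra (ZMod p) G)).injective p
    have h := (hN.hasWeightedFamily_top (K := ZMod p) (ρ := MonoidAlgebra.of (ZMod p) G)
      (IsPGroup.of_card hG) (Nat.sInf_mem hne) (pDegree p G)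
      (natCard_pLowerCentralSeries p G)).sliceRank_le hN.zero (by positivity) (by positivity)
    -- Cancelling `(p - 1)²` turns `W² / S` into `pDelta p G`.
    rw [mul_pow, mul_div_mul_left _ _ (pow_ne_zero 2 hp1.ne')] at h
    exact h
  · -- This case does not occur for a `p`-group, but the trivial bound disposes of it at once.
    have hl : pLength p G = 0 := by
      rw [pLength, Set.not_nonempty_iff_eq_empty.1 hne, Nat.sInf_empty]
    have hcard : (sliceRank (groupMulTensor (ZMod p) G) : ℝ) ≤ Nat.card G := by
      exact_mod_cast sliceRank_le_card (groupMulTensor (ZMod p) G)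
    have : pDelta p G = 0 := by simp [pDelta, hl]
    rw [this]
    simp only [neg_zero, zero_div, Real.exp_zero, mul_one]
    have : (0 : ℝ) ≤ Nat.card G := Nat.cast_nonneg _
    linarith

theorem theorem3p7 :
    (∀ (p : ℕ) [Fact p.Prime] (n : ℕ) (G : Type u) [Group G], Nat.card G = p ^ n →
      (sliceRank (groupMulTensor (ZMod p) G) : ℝ) ≤
        3 * (Nat.card G : ℝ) * Real.exp (-(pDelta p G) / 18)) ∧
    (∃ c : ℝ, 0 < c ∧ ∃ D : ℝ,
      ∀ (p : ℕ) [Fact p.Prime] (n : ℕ) (G : Type u) [Group G], Nat.card G = p ^ n →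
        D ≤ pDelta p G →
        (sliceRank (groupMulTensor (ZMod p) G) : ℝ) ≤
          (p : ℝ) ^ n / Real.exp (c * pDelta p G)) := by
  refine ⟨fun p _ n G _ hG => sliceRank_groupMulTensor_le_exp p n G hG,
    -- Half of the exponent `δ/18` is kept; the other half absorbs the factor `3` once `δ ≥ 36 log
    -- 3`.
    1 / 36, by norm_num, 36 * Real.log 3, fun p _ n G _ hG hD => ?_⟩
  refine (sliceRank_groupMulTensor_le_exp p n G hG).trans ?_
  have h3 : (3 : ℝ) ≤ Real.exp (1 / 36 * pDelta p G) := by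
    rw [← Real.log_le_iff_le_exp (by norm_num)]
    linarith
  have hsplit : Real.exp (-(pDelta p G) / 18) =
      (Real.exp (1 / 36 * pDelta p G))⁻¹ * (Real.exp (1 / 36 * pDelta p G))⁻¹ := by
    rw [← Real.exp_neg, ← Real.exp_add]
    congr 1
    ring
  set E := Real.exp (1 / 36 * pDelta p G)
  have hE : 0 < E := Real.exp_pos _
  rw [hsplit, hG, Nat.cast_pow, div_eq_mul_inv]
  calc 3 * (p : ℝ) ^ n * (E⁻¹ * E⁻¹) = (p : ℝ) ^ n * E⁻¹ * (3 * E⁻¹) := by ring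
    _ ≤ (p : ℝ) ^ n * E⁻¹ * 1 := by
        refine mul_le_mul_of_nonneg_left ?_ (by positivity)
        rwa [← div_eq_mul_inv, div_le_one hE]
    _ = _ := mul_one _
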